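/- **Notation.** Let $\mathbb{BC}$ be the algebra of bicomplex numbers, generated by two commuting imaginary units $\mathbf i,\mathbf j$; put $\mathbf k=\mathbf i\mathbf j$, $\mathbf e=\frac12(1+\mathbf k)$, $\mathbf e^\dagger=\frac12(1-\mathbf k)$, $\mathbb C=\mathbb C(\mathbf i)$, and write $Z=z_1\mathbf e+z_2\mathbf e^\dagger$ with $z_\ell=x_\ell+\mathbf i y_\ell\in\mathbb C$. All functions below are of product type, $H(Z)=h_1(z_1)\mathbf e+h_2(z_2)\mathbf e^\dagger$. Let $a_\ell<b_\ell$, $c_\ell<d_\ell$ be real $(\ell=1,2)$ and $$J_P^Q=([a_1,b_1]+\mathbf i[c_1,d_1])\,\mathbf e+([a_2,b_2]+\mathbf i[c_2,d_2])\,\mathbf e^\dagger .$$ Let $\vec\alpha=(\alpha_0,\dots,\alpha_3)$, $\vec\sigma=(\sigma_0,\dots,\sigma_3)\in(0,1)^4$ and also write $\sigma=(\sigma_0+\mathbf i\sigma_1)\mathbf e+(\sigma_2+\mathbf i\sigma_3)\mathbf e^\dagger$. Let $\vartheta=\vartheta_1\mathbf e+\vartheta_2\mathbf e^\dagger$ and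 $\varphi=\varphi_1\mathbf e+\varphi_2\mathbf e^\dagger$ with $\vartheta_\ell,\varphi_\ell\in C^1(\mathbb C,\mathbb C)$, and let $\phi=\phi_1\mathbf e+\phi_2\mathbf e^\dagger$ be $C^1$ on $J_P^Q$ with real $\phi_\ell\ge 0$ and $\partial\phi_\ell/\partial x_\ell>0$, $\partial\phi_\ell/\partial y_\ell>0$ on $[a_\ell,b_\ell]+\mathbf i[c_\ell,d_\ell]$. Put $$\frac{\partial}{\partial Z_{\vartheta\varphi}}=\Big(\vartheta_1\frac{\partial}{\partial x_1}+\varphi_1\frac{\partial}{\partial y_1}\Big)\mathbf e+\Big(\vartheta_2\frac{\partial}{\partial x_2}+\varphi_2\frac{\partial}{\partial y_2}\Big)\mathbf e^\dagger,\qquad D\phi=\sum_{\ell=1}^{2}\Big(\frac{\partial\phi_\ell}{\partial x_\ell}+\frac{\partial\phi_\ell}{\partial y_\ell}\Big)\mathbf e_\ell\quad(\mathbf e_1=\mathbf e,\ \mathbf e_2=\mathbf e^\dagger),$$ $$A_{\vartheta\varphi}=\sum_{\ell}\Big(\frac{\partial\,\mathrm{Re}\,\vartheta_\ell}{\partial x_\ell}+\frac{\partial\,\mathrm{Re}\,\varphi_\ell}{\partial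 y_\ell}\Big)\mathbf e_\ell,\qquad B_{\vartheta\varphi}=\sum_{\ell}\Big(\frac{\partial\,\mathrm{Im}\,\vartheta_\ell}{\partial x_\ell}+\frac{\partial\,\mathrm{Im}\,\varphi_\ell}{\partial y_\ell}\Big)\mathbf e_\ell .$$ Let $\lambda_\ell:[a_\ell,b_\ell]+\mathbf i[c_\ell,d_\ell]\to\mathbb R$ have both partial derivatives in the interior and satisfy there $$\Big(\vartheta_1\frac{\partial\lambda_1}{\partial x_1}+\varphi_1\frac{\partial\lambda_1}{\partial y_1}\Big)\mathbf e+\Big(\vartheta_2\frac{\partial\lambda_2}{\partial x_2}+\varphi_2\frac{\partial\lambda_2}{\partial y_2}\Big)\mathbf e^\dagger=D\phi(Z)\,\sigma^{-1}(1-\sigma);$$ write $e^\lambda=e^{\lambda_1}\mathbf e+e^{\lambda_2}\mathbf e^\dagger$. For $0<\beta<1$, $0<s<1$ and an increasing $C^1$ function $\psi$ let $$(I^{\beta,s,\psi}_{a^+}f)(t)=\frac{1}{s^\beta\,\Gamma(\beta)}\int_a^t e^{\frac{s-1}{s}(\psi(t)-\psi(\tau))}(\psi(t)-\psi(\tau))^{\beta-1}f(\tau)\,\psi'(\tau)\,d\tau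 .$$ Fix $W=w_1\mathbf e+w_2\mathbf e^\dagger\in J_P^Q$ and let $F=f_1\mathbf e+f_2\mathbf e^\dagger$ be such that $t\mapsto f_\ell(t+\mathbf i\,\mathrm{Im}\,w_\ell)$ is absolutely continuous on $[a_\ell,b_\ell]$ and $t\mapsto f_\ell(\mathrm{Re}\,w_\ell+\mathbf i t)$ is absolutely continuous on $[c_\ell,d_\ell]$ $(\ell=1,2)$. With $\phi_{\ell}^{x}(t)=\phi_\ell(t+\mathbf i\,\mathrm{Im}\,w_\ell)$ and $\phi_{\ell}^{y}(t)=\phi_\ell(\mathrm{Re}\,w_\ell+\mathbf i t)$ put $$I(Z)=(I_{a^+}^{1-\vec\alpha,\vec\sigma,\phi}F)(Z,W)=\sum_{\ell=1}^{2}\Big[\big(I_{a_\ell^+}^{1-\alpha_{2\ell-2},\,\sigma_{2\ell-2},\,\phi_\ell^x}f_\ell(\cdot+\mathbf i\,\mathrm{Im}\,w_\ell)\big)(x_\ell)+\big(I_{c_\ell^+}^{1-\alpha_{2\ell-1},\,\sigma_{2\ell-1},\,\phi_\ell^y}f_\ell(\mathrm{Re}\,w_\ell+\mathbf i\,\cdot)\big)(y_\ell)\Big]\mathbf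 e_\ell$$ and $$\frac{\partial^{\vec\alpha,\sigma,\phi}F(Z,W)}{\partial Z_{\vartheta\varphi,a^+}}=(1-\sigma)\,I(Z)+\sigma\,\frac{\big(\partial I/\partial Z_{\vartheta\varphi}\big)(Z)}{D\phi(Z)} .$$ Let $\Lambda\subset J_P^Q$ be a simply connected surface, including its boundary curve $\gamma$, parametrized over the closure of a bounded simply connected planar domain by a continuous map $R=R_1\mathbf e+R_2\mathbf e^\dagger$ such that, on that domain, $R_\ell$ is injective with image a bounded simply connected domain $\Lambda_\ell\subset\mathbb C$ $(\ell=1,2)$. Let $\gamma$ be parametrized by the restriction $r=r_1\mathbf e+r_2\mathbf e^\dagger$ of $R$ to the boundary of the parameter domain, itself traversed as a simple closed curve, and let $r_\ell$ parametrize $\gamma_\ell=\partial\Lambda_\ell$ as a positively oriented piecewise $C^1$ closed Jordan curve. For product-type functions put $$\int_\gamma H\,d\rho_{\vartheta\varphi}=\sum_{\ell=1}^{2}\Big(\int_{\gamma_\ell}h_\ell\,(\vartheta_\ell\,dy_\ell-\varphi_\ell\,dx_\ell)\Big)\mathbf e_\ell,\qquad \int_\Lambda H\,dZ\wedge dZ^*=\sum_{\ell=1}^{2}\Big(\int_{\Lambda_\ell}h_\ell\,dz_\ell\wedge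 d\bar z_\ell\Big)\mathbf e_\ell,$$ where $dz_\ell\wedge d\bar z_\ell=-2\mathbf i\,dx_\ell\,dy_\ell$. **Corollary.** Assume that $e^{\lambda}\,I$ is continuous on $J_P^Q$ and $C^1$ in its interior, and that $$\frac{\partial^{\vec\alpha,\sigma,\phi}F(Z,W)}{\partial Z_{\vartheta\varphi,a^+}}=0$$ for all $Z$ in the interior of $J_P^Q$. Then $$\int_\gamma e^{\lambda}\,I\,d\rho_{\vartheta\varphi}=\frac{\mathbf i}{2}\int_\Lambda\Big[A_{\vartheta\varphi}\,e^{\lambda}\,I+B_{\vartheta\varphi}\,\mathbf i\,e^{\lambda}\,I\Big]\,dZ\wedge dZ^* ,$$ that is, the boundary integral equals the integral of $(A_{\vartheta\varphi}+B_{\vartheta\varphi}\mathbf i)\,e^{\lambda}\,I$ over $\Lambda$ with respect to the area elements $dx_1dy_1$, $dx_2dy_2$ in the two components. -/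

import Mathlib

open Set Complex MeasureTheory Topology

noncomputable section

namespace BicomplexWeighted

/-! ### Bicomplex numbers

The algebra of bicomplex numbers in its idempotent representation over `ℂ(i)`: the pair
`(z₁, z₂)` is the bicomplex number `z₁ e + z₂ e†`; all operations are componentwise. -/

/-- Bicomplex numbers `z₁ e + z₂ e†`, written as pairs `(z₁, z₂)`. -/
abbrev BC : Type := ℂ × ℂ

/-- The idempotent `e = (1 + k) / 2`. -/
def bcE : BC := (1, 0)
/-- The idempotent `e† = (1 - k) / 2`. -/
def bcEd : BC := (0, 1)
/-- The imaginary unit `i`. -/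
def bcI : BC := (I, I)
/-- The imaginary unit `j`. -/
def bcJ : BC := (-I, I)
/-- The hyperbolic unit `k = i j`. -/
def bcK : BC := (1, -1)

theorem bcI_mul_bcI : bcI * bcI = -1 := by ext <;> simp [bcI]
theorem bcJ_mul_bcJ : bcJ * bcJ = -1 := by ext <;> simp [bcJ]
theorem bcI_mul_bcJ : bcI * bcJ = bcK := by ext <;> simp [bcI, bcJ, bcK]
theorem bcE_eq : bcE = (1 / 2 : ℂ) • (1 + bcK) := by
  ext <;> norm_num [bcE, bcK]
theorem bcEd_eq : bcEd = (1 / 2 : ℂ) • (1 - bcK) := by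
  ext <;> norm_num [bcEd, bcK]
theorem bc_idempotent_repr (Z : BC) : Z = Z.1 • bcE + Z.2 • bcEd := by
  ext <;> simp [bcE, bcEd]
/-- Every bicomplex number is `z + w j` for exactly one pair of complex numbers `z`, `w`. -/
theorem bc_cartesian_repr (Z : BC) :
    ∃! p : ℂ × ℂ, Z = p.1 • (1 : BC) + p.2 • bcJ := by
  refine ⟨((Z.1 + Z.2) / 2, I * (Z.1 - Z.2) / 2), ?_, ?_⟩
  · ext
    · simp [bcJ]; linear_combination (Z.1 - Z.2) / 2 * I_mul_I
    · simp [bcJ]; linear_combination (-(Z.1 - Z.2) / 2) * I_mul_I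
  · rintro ⟨z, w⟩ h
    have h1 : Z.1 = z - w * I := by rw [h]; simp [bcJ]; ring
    have h2 : Z.2 = z + w * I := by rw [h]; simp [bcJ]
    ext
    · simp [h1, h2]
    · simp only [h1, h2]; linear_combination w * I_mul_I

/-! ### Functions of product type -/

/-- A function of product type, `F (z₁ e + z₂ e†) = f₁(z₁) e + f₂(z₂) e†`, given by its two
components `f₁, f₂ : ℂ → K` (`K = ℂ` for bicomplex values, `K = ℝ` for hyperbolic values).
Sums, products and quotients are taken pointwise in each component, i.e. in the bicomplex
algebra. -/
abbrev ProductFun (K : Type) : Type := (ℂ → K) × (ℂ → K)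

/-- The bicomplex function `Z ↦ f₁(z₁) e + f₂(z₂) e†`. -/
def bcEval (F : ProductFun ℂ) (Z : BC) : BC := (F.1 Z.1, F.2 Z.2)

theorem bcEval_eq (F : ProductFun ℂ) (Z : BC) :
    bcEval F Z = F.1 Z.1 • bcE + F.2 Z.2 • bcEd := by
  ext <;> simp [bcE, bcEd, bcEval]

/-- The constant function with bicomplex value `C`. -/
def bcConst (C : BC) : ProductFun ℂ := (fun _ => C.1, fun _ => C.2)

/-- A hyperbolic-valued function, seen as bicomplex-valued. -/
def bcOfReal (L : ProductFun ℝ) : ProductFun ℂ := (fun z => (L.1 z : ℂ), fun z => (L.2 z : ℂ))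

/-- `e^{λ₁} e + e^{λ₂} e†`. -/
def bcExp (L : ProductFun ℝ) : ProductFun ℂ :=
  (fun z => (Real.exp (L.1 z) : ℂ), fun z => (Real.exp (L.2 z) : ℂ))

/-! ### The box `J_P^Q`, with `P = (a₁, c₁, a₂, c₂)` and `Q = (b₁, d₁, b₂, d₂)` -/

/-- `[a₁, b₁] + i [c₁, d₁]`. -/
def boxFst (P Q : Fin 4 → ℝ) : Set ℂ := Icc (P 0) (Q 0) ×ℂ Icc (P 1) (Q 1)
/-- `[a₂, b₂] + i [c₂, d₂]`. -/
def boxSnd (P Q : Fin 4 → ℝ) : Set ℂ := Icc (P 2) (Q 2) ×ℂ Icc (P 3) (Q 3)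
/-- `J_P^Q = ([a₁, b₁] + i [c₁, d₁]) e + ([a₂, b₂] + i [c₂, d₂]) e†`. -/
def box (P Q : Fin 4 → ℝ) : Set BC := boxFst P Q ×ˢ boxSnd P Q

/-! ### Weighted Cauchy-Riemann operators -/

/-- `∂f/∂x` for a function of `z = x + i y`. -/
def pdX {E : Type} [NormedAddCommGroup E] [NormedSpace ℝ E] (f : ℂ → E) (z : ℂ) : E :=
  lineDeriv ℝ f z 1
/-- `∂f/∂y` for a function of `z = x + i y`. -/
def pdY {E : Type} [NormedAddCommGroup E] [NormedSpace ℝ E] (f : ℂ → E) (z : ℂ) : E :=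
  lineDeriv ℝ f z I

/-- `∂H/∂Z_{ϑφ} = (ϑ₁ ∂h₁/∂x₁ + φ₁ ∂h₁/∂y₁) e + (ϑ₂ ∂h₂/∂x₂ + φ₂ ∂h₂/∂y₂) e†`
for the weight `(ϑ, φ) = (th, vphi)`. -/
def weightedCR (th vphi H : ProductFun ℂ) : ProductFun ℂ :=
  (fun z => th.1 z * pdX H.1 z + vphi.1 z * pdY H.1 z,
   fun z => th.2 z * pdX H.2 z + vphi.2 z * pdY H.2 z)

/-- `A_{ϑφ}`: the divergence of the real parts of the weights. -/
def weightA (th vphi : ProductFun ℂ) : ProductFun ℂ :=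
  (fun z => ((pdX (fun u => (th.1 u).re) z + pdY (fun u => (vphi.1 u).re) z : ℝ) : ℂ),
   fun z => ((pdX (fun u => (th.2 u).re) z + pdY (fun u => (vphi.2 u).re) z : ℝ) : ℂ))

/-- `B_{ϑφ}`: the divergence of the imaginary parts of the weights. -/
def weightB (th vphi : ProductFun ℂ) : ProductFun ℂ :=
  (fun z => ((pdX (fun u => (th.1 u).im) z + pdY (fun u => (vphi.1 u).im) z : ℝ) : ℂ),
   fun z => ((pdX (fun u => (th.2 u).im) z + pdY (fun u => (vphi.2 u).im) z : ℝ) : ℂ))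

/-- `Dφ = (∂φ₁/∂x₁ + ∂φ₁/∂y₁) e + (∂φ₂/∂x₂ + ∂φ₂/∂y₂) e†` for hyperbolic-valued `φ`. -/
def sumPartials (phi : ProductFun ℝ) : ProductFun ℂ :=
  (fun z => ((pdX phi.1 z + pdY phi.1 z : ℝ) : ℂ),
   fun z => ((pdX phi.2 z + pdY phi.2 z : ℝ) : ℂ))

/-! ### Proportional fractional integrals -/

/-- The left proportional fractional integral `I_{a+}^{β,σ,φ} f` of order `β > 0` and proportion
`σ ∈ (0, 1]` with respect to `φ`:
`1 / (σ^β Γ(β)) ∫_a^t e^{((σ-1)/σ) (φ t - φ τ)} (φ t - φ τ)^(β-1) f τ φ' τ dτ`. -/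
def propFracInt (a β σ : ℝ) (phi : ℝ → ℝ) (f : ℝ → ℂ) (t : ℝ) : ℂ :=
  ((σ ^ β * Real.Gamma β : ℝ) : ℂ)⁻¹ *
    ∫ τ in a..t, ((Real.exp ((σ - 1) / σ * (phi t - phi τ)) * (phi t - phi τ) ^ (β - 1) : ℝ) : ℂ) *
      f τ * ((deriv phi τ : ℝ) : ℂ)

/-- `F ∈ AC¹(J_P^Q, BC)` relative to the point `W`: the four coordinate slices of `F` through `W`
are absolutely continuous. -/
def IsAC1 (P Q : Fin 4 → ℝ) (W : BC) (F : ProductFun ℂ) : Prop :=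
  AbsolutelyContinuousOnInterval (fun t => F.1 ⟨t, W.1.im⟩) (P 0) (Q 0) ∧
  AbsolutelyContinuousOnInterval (fun t => F.1 ⟨W.1.re, t⟩) (P 1) (Q 1) ∧
  AbsolutelyContinuousOnInterval (fun t => F.2 ⟨t, W.2.im⟩) (P 2) (Q 2) ∧
  AbsolutelyContinuousOnInterval (fun t => F.2 ⟨W.2.re, t⟩) (P 3) (Q 3)

/-- `Z ↦ (I_{a+}^{1-α,σ,φ} F)(Z, W)`. -/
def bcFracInt (P α σ : Fin 4 → ℝ) (phi : ProductFun ℝ) (F : ProductFun ℂ) (W : BC) :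
    ProductFun ℂ :=
  (fun z =>
     propFracInt (P 0) (1 - α 0) (σ 0) (fun t => phi.1 ⟨t, W.1.im⟩) (fun t => F.1 ⟨t, W.1.im⟩) z.re +
     propFracInt (P 1) (1 - α 1) (σ 1) (fun t => phi.1 ⟨W.1.re, t⟩) (fun t => F.1 ⟨W.1.re, t⟩) z.im,
   fun z =>
     propFracInt (P 2) (1 - α 2) (σ 2) (fun t => phi.2 ⟨t, W.2.im⟩) (fun t => F.2 ⟨t, W.2.im⟩) z.re +
     propFracInt (P 3) (1 - α 3) (σ 3) (fun t => phi.2 ⟨W.2.re, t⟩) (fun t => F.2 ⟨W.2.re, t⟩) z.im)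

/-- The bicomplex number `(σ₀ + i σ₁) e + (σ₂ + i σ₃) e†`, also denoted `σ`. -/
def bcSigma (σ : Fin 4 → ℝ) : BC :=
  ((σ 0 : ℂ) + I * (σ 1 : ℂ)) • bcE + ((σ 2 : ℂ) + I * (σ 3 : ℂ)) • bcEd

/-- The operator `∂^{α,σ,φ}F(Z, W)/∂Z_{ϑφ,a+}
= (1 - σ) I_{a+}^{1-α,σ,φ}F(Z, W) + σ (∂/∂Z_{ϑφ} I_{a+}^{1-α,σ,φ}F)(Z, W) / Dφ(Z)`. -/
def fracWeightedCR (P α σ : Fin 4 → ℝ) (phi : ProductFun ℝ) (th vphi F : ProductFun ℂ) (W : BC) :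
    ProductFun ℂ :=
  bcConst (1 - bcSigma σ) * bcFracInt P α σ phi F W +
    bcConst (bcSigma σ) * (weightedCR th vphi (bcFracInt P α σ phi F W) / sumPartials phi)

/-! ### Curves, surfaces and integrals -/

/-- A piecewise `C¹` path: away from finitely many parameters it is `C¹`, up to the end points of
each closed piece. -/
def IsPiecewiseC1 {p q : ℂ} (r : Path p q) : Prop :=
  ∃ T : Finset ℝ, ∀ s t : ℝ, s < t → Icc s t ⊆ Icc 0 1 → Disjoint (Ioo s t) (T : Set ℝ) →
    ContDiffOn ℝ 1 r.extend (Icc s t)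

/-- A closed path without self-intersections. -/
def IsSimpleClosed {p : ℂ} (r : Path p p) : Prop :=
  ∀ s t : unitInterval, s < t → r s = r t → s = 0 ∧ t = 1

/-- The winding number of a closed path about `w`. -/
def windingNumber {p : ℂ} (r : Path p p) (w : ℂ) : ℂ :=
  (2 * Real.pi * Complex.I)⁻¹ *
    ∫ᶜ z in r, ContinuousLinearMap.toSpanSingleton ℂ ((z - w)⁻¹)

/-- `D` is a bounded simply connected domain whose boundary is the piecewise smooth closed Jordan
curve `r`, positively oriented: `r` winds once around the points of `D` and does not wind around
the points outside of `closure D`. -/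
structure IsJordanDomain (D : Set ℂ) {p : ℂ} (r : Path p p) : Prop where
  isOpen : IsOpen D
  simplyConnected : IsSimplyConnected D
  bounded : Bornology.IsBounded D
  simple : IsSimpleClosed r
  piecewise : IsPiecewiseC1 r
  range_eq : range r = frontier D
  winding_inside : ∀ w ∈ D, windingNumber r w = 1
  winding_outside : ∀ w ∉ closure D, windingNumber r w = 0

/-- A simply connected surface `Λ` in the bicomplex numbers, parametrized by `R = R₁ e + R₂ e†`
over the closure of a parameter domain `U` bounded by the closed curve `β`, with boundary curve
`r = r₁ e + r₂ e† = R ∘ β`; here `R₁`, `R₂` parametrize simply connected domains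
`Λ₁`, `Λ₂` of `ℂ` whose boundaries are the piecewise smooth closed Jordan curves `r₁`, `r₂`. -/
structure Surface where
  U : Set ℂ
  u₀ : ℂ
  β : Path u₀ u₀
  R : ℂ → BC
  p : BC
  r₁ : Path p.1 p.1
  r₂ : Path p.2 p.2
  isOpen_U : IsOpen U
  simplyConnected_U : IsSimplyConnected U
  bounded_U : Bornology.IsBounded U
  simple_β : IsSimpleClosed β
  range_β : range β = frontier U
  continuousOn_R : ContinuousOn R (closure U)
  injOn_R₁ : InjOn (fun u => (R u).1) U
  injOn_R₂ : InjOn (fun u => (R u).2) U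
  boundary : ∀ t : unitInterval, R (β t) = (r₁ t, r₂ t)
  jordan₁ : IsJordanDomain ((fun u => (R u).1) '' U) r₁
  jordan₂ : IsJordanDomain ((fun u => (R u).2) '' U) r₂

namespace Surface

/-- The surface `Λ`, together with its boundary `γ`. -/
def carrier (S : Surface) : Set BC := S.R '' closure S.U
/-- The planar domain `Λ₁`. -/
def dom₁ (S : Surface) : Set ℂ := (fun u => (S.R u).1) '' S.U
/-- The planar domain `Λ₂`. -/
def dom₂ (S : Surface) : Set ℂ := (fun u => (S.R u).2) '' S.U

end Surface

/-- The complex-valued real 1-form `h dρ_ψ = h (ψ₀ dy - ψ₁ dx)`. -/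
def rhoForm (ψ₀ ψ₁ h : ℂ → ℂ) (z : ℂ) : ℂ →L[ℝ] ℂ :=
  h z • (ψ₀ z • (ofRealCLM.comp imCLM) - ψ₁ z • (ofRealCLM.comp reCLM))

/-- `∫_γ H dρ_{ϑφ} = e ∫_{γ₁} h₁ dρ_{ϑ₁φ₁} + e† ∫_{γ₂} h₂ dρ_{ϑ₂φ₂}`. -/
def boundaryIntegral (S : Surface) (th vphi H : ProductFun ℂ) : BC :=
  (∫ᶜ z in S.r₁, rhoForm th.1 vphi.1 H.1 z) • bcE +
    (∫ᶜ z in S.r₂, rhoForm th.2 vphi.2 H.2 z) • bcEd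

/-- `∫_D h dz ∧ dz̄`, where `dz ∧ dz̄ = -2 i dx dy`. -/
def wedgeIntegral (D : Set ℂ) (h : ℂ → ℂ) : ℂ := (-2 * Complex.I) * ∫ z in D, h z

/-- `∫_Λ H dZ ∧ dZ^* = (∫_{Λ₁} h₁ dz₁ ∧ dz̄₁) e + (∫_{Λ₂} h₂ dz₂ ∧ dz̄₂) e†`. -/
def surfaceIntegral (S : Surface) (H : ProductFun ℂ) : BC :=
  wedgeIntegral S.dom₁ H.1 • bcE + wedgeIntegral S.dom₂ H.2 • bcEd

end BicomplexWeighted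

end

open scoped ComplexConjugate

/-! The statement splits into its two idempotent components. In one component write `X = θ ∂/∂x + φ
∂/∂y`, `s` for the component of `σ`, `E` for that of `Dφ`, and `G` for that of the fractional
integral. The equation for `λ` reads `Xλ = E (1 - s) / s`, so `e^λ` is an integrating factor: the
vanishing of `(1 - s) G + s XG / E` is equivalent to `Xh = 0` for `h = e^λ G`. Hence the field `(hθ,
hφ)` has divergence `h (θ_x + φ_y)`, and `θ_x + φ_y = A + iB`. The corollary is then Green's theorem
in divergence form, with `i/2` undoing the factor `-2i` of `dz ∧ dz̄`.

The main work is Green's theorem for a domain described by winding numbers. The Cauchy–Pompeiu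
formula `integral_twoDbar_div`, integrated along the curve and combined with Fubini, gives `∮ f dz =
i ∫ (f_x + i f_y) ind` in `integral_mul_deriv_eq_integral_twoDbar`. The index is almost everywhere
the indicator of the domain, because the curve is a null set. Splitting `u dy - v dx` into a `dz`
part and a conjugated `dz` part yields the divergence form.

A cutoff removes the compact support. Since the closed domain may touch the boundary of the box,
where `h` is only continuous, `IsJordanDomain.green_of_convex` shrinks the field towards an interior
point and passes to the limit. -/

namespace BicomplexWeighted

/-! ### The Cauchy–Pompeiu formula -/

/-- The field `∂f/∂x + i ∂f/∂y`, i.e. twice the Wirtinger derivative `∂f/∂z̄`. -/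
noncomputable def twoDbar (f : ℂ → ℂ) (z : ℂ) : ℂ := fderiv ℝ f z 1 + I * fderiv ℝ f z I

theorem continuous_twoDbar {f : ℂ → ℂ} (hf : ContDiff ℝ 1 f) : Continuous (twoDbar f) := by
  have h := hf.continuous_fderiv one_ne_zero
  unfold twoDbar
  fun_prop

theorem hasCompactSupport_twoDbar {f : ℂ → ℂ} (hf : HasCompactSupport f) :
    HasCompactSupport (twoDbar f) := by
  have h := hf.fderiv ℝ
  refine h.mono' (fun z hz => subset_tsupport _ ?_)
  contrapose! hz
  simp only [Function.mem_support, not_not] at hz ⊢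
  simp [twoDbar, hz]

theorem integrableOn_of_continuous_of_eq_zero {g : ℝ × ℝ → ℂ} (hg : Continuous g) {R : ℝ}
    (h : ∀ p : ℝ × ℝ, R < p.1 → g p = 0) :
    IntegrableOn g (Ioi 0 ×ˢ Ioo (-Real.pi) Real.pi) := by
  have h1 : IntegrableOn g (Icc 0 R ×ˢ Icc (-Real.pi) Real.pi) :=
    hg.continuousOn.integrableOn_compact (isCompact_Icc.prod isCompact_Icc)
  refine h1.of_forall_sdiff_eq_zero (measurableSet_Ioi.prod measurableSet_Ioo) fun p hp => h p ?_
  by_contra hR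
  exact hp.2 ⟨⟨le_of_lt hp.1.1, not_lt.1 hR⟩, Ioo_subset_Icc_self hp.1.2⟩

/-- In polar coordinates about `z` the Jacobian `ρ` cancels the modulus of the kernel, and the
integrand becomes `∂f/∂ρ + (i/ρ) ∂f/∂θ`. The radial term integrates to `-f z` on each ray; the
angular term integrates to zero on each circle by periodicity. -/
theorem integral_twoDbar_div {f : ℂ → ℂ} (hf : ContDiff ℝ 1 f) (hc : HasCompactSupport f) (z : ℂ) :
    ∫ w, twoDbar f w / (w - z) = -(2 * Real.pi) * f z := by
  obtain ⟨R, hR⟩ := hc.isCompact.isBounded.subset_closedBall z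
  have hvan : ∀ w, R < ‖w - z‖ → fderiv ℝ f w = 0 := by
    intro w hw
    by_contra hne
    have : w ∈ tsupport f := support_fderiv_subset ℝ hne
    have := hR this
    rw [mem_closedBall_iff_norm] at this
    linarith
  have hd : Differentiable ℝ f := hf.differentiable one_ne_zero
  have hcd := hf.continuous_fderiv one_ne_zero
  set e : ℝ → ℂ := fun θ => Real.cos θ + Real.sin θ * I with he
  have hec : Continuous e := by fun_prop
  have hne : ∀ θ, ‖e θ‖ = 1 := fun θ => by
    have := norm_exp_ofReal_mul_I θ
    rwa [exp_mul_I, ← ofReal_cos, ← ofReal_sin] at this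
  -- `A` is the radial derivative of `f`, and `B` is the angular derivative divided by `ρ`; in this
  -- form both are continuous up to `ρ = 0`.
  set A : ℝ × ℝ → ℂ := fun p => fderiv ℝ f (z + p.1 * e p.2) (e p.2) with hA
  set B : ℝ × ℝ → ℂ := fun p => fderiv ℝ f (z + p.1 * e p.2) (I * e p.2) with hB
  have hAc : Continuous A := by fun_prop
  have hBc : Continuous B := by fun_prop
  have hz : ∀ p : ℝ × ℝ, max R 0 < p.1 → fderiv ℝ f (z + p.1 * e p.2) = 0 := by
    intro p hp
    apply hvan
    rw [add_sub_cancel_left, norm_mul, hne, norm_real, Real.norm_eq_abs, mul_one]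
    exact lt_of_lt_of_le (lt_of_le_of_lt (le_max_left _ _) hp) (le_abs_self _)
  have hAi := integrableOn_of_continuous_of_eq_zero hAc (R := max R 0) (fun p hp => by simp [hA, hz p hp])
  have hBi := integrableOn_of_continuous_of_eq_zero hBc (R := max R 0) (fun p hp => by simp [hB, hz p hp])
  have key : ∫ w, twoDbar f w / (w - z) =
      ∫ p in Ioi (0 : ℝ) ×ˢ Ioo (-Real.pi) Real.pi, (A p + I * B p) := by
    rw [← integral_add_right_eq_self _ z, ← Complex.integral_comp_polarCoord_symm,
      polarCoord_target]
    refine setIntegral_congr_fun (measurableSet_Ioi.prod measurableSet_Ioo) fun p hp => ?_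
    have hp0 : (p.1 : ℂ) ≠ 0 := ofReal_ne_zero.2 (ne_of_gt hp.1)
    have he0 : e p.2 ≠ 0 := fun h => by have := hne p.2; simp [h] at this
    have hsq : (Real.cos p.2 : ℂ) ^ 2 + (Real.sin p.2 : ℂ) ^ 2 = 1 := by
      exact_mod_cast Real.cos_sq_add_sin_sq p.2
    have h1 : e p.2 = Real.cos p.2 • (1 : ℂ) + Real.sin p.2 • I := by simp [he]
    have h2 : I * e p.2 = (-Real.sin p.2) • (1 : ℂ) + Real.cos p.2 • I := by
      simp only [he, real_smul, ofReal_neg]; linear_combination (Real.sin p.2 : ℂ) * I_mul_I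
    have hA' : A p = Real.cos p.2 * fderiv ℝ f (z + p.1 * e p.2) 1
        + Real.sin p.2 * fderiv ℝ f (z + p.1 * e p.2) I := by
      simp only [hA]
      conv_lhs => enter [2]; rw [h1]
      rw [map_add, map_smul, map_smul, real_smul, real_smul]
    have hB' : B p = -Real.sin p.2 * fderiv ℝ f (z + p.1 * e p.2) 1
        + Real.cos p.2 * fderiv ℝ f (z + p.1 * e p.2) I := by
      simp only [hB]
      rw [h2, map_add, map_smul, map_smul, real_smul, real_smul, ofReal_neg]
    simp only [Complex.polarCoord_symm_apply, add_sub_cancel_right]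
    rw [hA', hB', twoDbar, add_comm _ z, real_smul]
    change (p.1 : ℂ) * (_ / (p.1 * e p.2)) = _
    rw [mul_div_assoc', mul_div_mul_left _ _ hp0, div_eq_iff he0]
    change _ = _ * ((Real.cos p.2 : ℂ) + Real.sin p.2 * I)
    generalize fderiv ℝ f (z + p.1 * e p.2) 1 = X
    generalize fderiv ℝ f (z + p.1 * e p.2) I = Y
    linear_combination (-(X + I * Y)) * hsq +
      ((Real.sin p.2 : ℂ) ^ 2 * X - Real.sin p.2 * Real.cos p.2 * Y) * I_mul_I
  rw [key, integral_add hAi (hBi.const_mul I), integral_const_mul]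
  have iA : ∫ p in Ioi (0 : ℝ) ×ˢ Ioo (-Real.pi) Real.pi, A p = -(2 * Real.pi) * f z := by
    rw [IntegrableOn, Measure.volume_eq_prod, ← Measure.prod_restrict] at hAi
    rw [Measure.volume_eq_prod, ← Measure.prod_restrict, integral_prod_symm _ hAi]
    have hin : ∀ θ : ℝ, ∫ ρ in Ioi (0 : ℝ), A (ρ, θ) = -f z := by
      intro θ
      have hder : ∀ ρ : ℝ, HasDerivAt (fun ρ : ℝ => f (z + ρ * e θ)) (A (ρ, θ)) ρ := by
        intro ρ
        have h1 : HasDerivAt (fun ρ : ℝ => z + ρ * e θ) (e θ) ρ := by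
          simpa using ((hasDerivAt_id ρ).ofReal_comp.mul_const (e θ)).const_add z
        exact (hd _).hasFDerivAt.comp_hasDerivAt ρ h1
      have hs : HasCompactSupport (fun ρ : ℝ => f (z + ρ * e θ)) := by
        refine HasCompactSupport.intro (isCompact_Icc (a := -R) (b := R)) fun ρ hρ => ?_
        by_contra hne'
        have h2 := hR (subset_tsupport f hne')
        rw [mem_closedBall_iff_norm, add_sub_cancel_left, norm_mul, hne, norm_real, mul_one,
          Real.norm_eq_abs, abs_le] at h2
        exact hρ h2
      have hcd1 : ContDiff ℝ 1 (fun ρ : ℝ => f (z + ρ * e θ)) :=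
        hf.comp (contDiff_const.add (ofRealCLM.contDiff.mul contDiff_const))
      have := hs.integral_Ioi_deriv_eq hcd1 0
      simpa [(hder _).deriv] using this
    simp only [hin, integral_const, MeasurableSet.univ, measureReal_restrict_apply, univ_inter,
      Real.volume_real_Ioo, real_smul]
    rw [max_eq_left (by linarith [Real.pi_pos])]
    push_cast
    ring
  have iB : ∫ p in Ioi (0 : ℝ) ×ˢ Ioo (-Real.pi) Real.pi, B p = 0 := by
    rw [Measure.volume_eq_prod, setIntegral_prod _ hBi]
    refine setIntegral_eq_zero_of_forall_eq_zero fun ρ hρ => ?_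
    rw [← integral_Ioc_eq_integral_Ioo, ← intervalIntegral.integral_of_le (by linarith [Real.pi_pos])]
    have hder : ∀ θ : ℝ, HasDerivAt (fun θ : ℝ => (ρ : ℂ)⁻¹ * f (z + ρ * e θ)) (B (ρ, θ)) θ := by
      intro θ
      have h1 : HasDerivAt e (I * e θ) θ := by
        have := ((Real.hasDerivAt_cos θ).ofReal_comp).add
          ((Real.hasDerivAt_sin θ).ofReal_comp.mul_const I)
        refine this.congr_deriv ?_
        simp only [he, ofReal_neg]
        linear_combination (-Real.sin θ : ℂ) * I_mul_I
      have h2 := ((hd (z + ρ * e θ)).hasFDerivAt.comp_hasDerivAt θ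
        ((h1.const_mul (ρ : ℂ)).const_add z)).const_mul (ρ : ℂ)⁻¹
      refine h2.congr_deriv ?_
      rw [show (ρ : ℂ) * (I * e θ) = ρ • (I * e θ) from real_smul.symm, map_smul, real_smul, ← mul_assoc,
        inv_mul_cancel₀ (ofReal_ne_zero.2 (ne_of_gt hρ)), one_mul]
    rw [intervalIntegral.integral_eq_sub_of_hasDerivAt (fun θ _ => hder θ)
      ((by fun_prop : Continuous fun θ => B (ρ, θ)).intervalIntegrable _ _)]
    simp [he]
  rw [iA, iB]; simp

/-! ### Piecewise `C¹` paths: bounded speed and null range -/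

/-- Induction on the number of exceptional parameters inside an interval, splitting at one of them.
On an interval without any, the one-sided derivative is continuous up to the end points, hence
bounded by compactness. -/
theorem IsPiecewiseC1.exists_deriv_bound {p q : ℂ} {r : Path p q} (hr : IsPiecewiseC1 r) :
    ∃ (T : Finset ℝ) (C : ℝ), ∀ t ∈ Ioo (0 : ℝ) 1, t ∉ T →
      DifferentiableAt ℝ r.extend t ∧ ‖deriv r.extend t‖ ≤ C := by
  classical
  obtain ⟨T, hT⟩ := hr
  have key : ∀ n : ℕ, ∀ a b : ℝ, a < b → Icc a b ⊆ Icc 0 1 → (T.filter (· ∈ Ioo a b)).card = n →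
      ∃ C : ℝ, ∀ t ∈ Ioo a b, t ∉ T → DifferentiableAt ℝ r.extend t ∧ ‖deriv r.extend t‖ ≤ C := by
    intro n
    induction n using Nat.strong_induction_on with
    | _ n ih =>
    intro a b hab hsub hn
    by_cases hne : ∃ τ ∈ T, τ ∈ Ioo a b
    · obtain ⟨τ, hτT, hτ⟩ := hne
      have hlt : ∀ c d : ℝ, a ≤ c → d ≤ b → (d ≤ τ ∨ τ ≤ c) →
          (T.filter (· ∈ Ioo c d)).card < n := by
        intro c d hc hd h
        rw [← hn]
        refine Finset.card_lt_card (Finset.ssubset_iff_of_subset ?_ |>.2 ⟨τ, ?_, ?_⟩)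
        · intro x hx
          simp only [Finset.mem_filter, mem_Ioo] at hx ⊢
          exact ⟨hx.1, by linarith, by linarith⟩
        · simpa using ⟨hτT, hτ⟩
        · simp only [Finset.mem_filter, mem_Ioo, not_and]
          intro _ h1 h2
          rcases h with h | h <;> linarith
      obtain ⟨C₁, h₁⟩ := ih _ (hlt a τ le_rfl hτ.2.le (Or.inl le_rfl)) a τ hτ.1
        ((Icc_subset_Icc_right hτ.2.le).trans hsub) rfl
      obtain ⟨C₂, h₂⟩ := ih _ (hlt τ b hτ.1.le le_rfl (Or.inr le_rfl)) τ b hτ.2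
        ((Icc_subset_Icc_left hτ.1.le).trans hsub) rfl
      refine ⟨max C₁ C₂, fun t ht htT => ?_⟩
      rcases lt_trichotomy t τ with h | h | h
      · exact (h₁ t ⟨ht.1, h⟩ htT).imp_right (le_max_of_le_left ·)
      · exact absurd (h ▸ hτT) htT
      · exact (h₂ t ⟨h, ht.2⟩ htT).imp_right (le_max_of_le_right ·)
    · push Not at hne
      have hcd := hT a b hab hsub (Set.disjoint_left.2 fun x hx hxT => hne x hxT hx)
      obtain ⟨C, hC⟩ := isCompact_Icc.exists_bound_of_continuousOn
        (hcd.continuousOn_derivWithin (uniqueDiffOn_Icc hab) le_rfl)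
      refine ⟨C, fun t ht _ => ?_⟩
      have hnhds : Icc a b ∈ 𝓝 t := Icc_mem_nhds ht.1 ht.2
      refine ⟨(hcd.differentiableOn one_ne_zero).differentiableAt hnhds, ?_⟩
      rw [← derivWithin_of_mem_nhds hnhds]
      exact hC t (Ioo_subset_Icc_self ht)
  obtain ⟨C, hC⟩ := key _ 0 1 one_pos le_rfl rfl
  exact ⟨T, C, hC⟩

theorem IsPiecewiseC1.exists_ae_deriv_bound {p q : ℂ} {r : Path p q} (hr : IsPiecewiseC1 r) :
    ∃ C : ℝ, 0 ≤ C ∧ ∀ᵐ t ∂(volume.restrict (Ioc (0 : ℝ) 1)), ‖deriv r.extend t‖ ≤ C := by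
  obtain ⟨T, C, hC⟩ := hr.exists_deriv_bound
  refine ⟨max C 0, le_max_right _ _, ?_⟩
  rw [← restrict_Ioo_eq_restrict_Ioc]
  have h0 : ∀ᵐ t ∂(volume.restrict (Ioo (0 : ℝ) 1)), t ∉ T :=
    ae_restrict_of_ae ((Finset.finite_toSet T).countable.ae_notMem volume)
  filter_upwards [h0, ae_restrict_mem measurableSet_Ioo] with t ht ht'
  exact le_max_of_le_left (hC t ht' ht).2

/-- Viewing the path as the planar map `z ↦ r (Re z)`, its range is, up to finitely many points, the
image of a subset of the real line. That subset is null in the plane, and differentiable maps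
between spaces of equal dimension preserve null sets. -/
theorem IsPiecewiseC1.volume_range {p q : ℂ} {r : Path p q} (hr : IsPiecewiseC1 r) :
    volume (range r) = 0 := by
  obtain ⟨T, C, hC⟩ := hr.exists_deriv_bound
  set S : Set ℂ := {z | z.im = 0 ∧ z.re ∈ Ioo (0 : ℝ) 1 ∧ z.re ∉ T}
  set g : ℂ → ℂ := fun z => r.extend z.re with hg
  have hS : volume S = 0 := by
    refine measure_mono_null (t := (LinearMap.ker imLm : Submodule ℝ ℂ)) (fun z hz => hz.1) ?_
    refine Measure.addHaar_submodule _ _ fun h => ?_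
    have : I ∈ LinearMap.ker imLm := h ▸ Submodule.mem_top
    simp at this
  have hd : DifferentiableOn ℝ g S := fun z hz =>
    ((hC z.re hz.2.1 hz.2.2).1.comp z reCLM.differentiableAt).differentiableWithinAt
  have hgS := addHaar_image_eq_zero_of_differentiableOn_of_addHaar_eq_zero volume hd hS
  have hfin : (r.extend '' (insert 0 (insert 1 (T : Set ℝ)))).Finite :=
    ((Finset.finite_toSet T).insert 1 |>.insert 0).image _
  refine measure_mono_null (t := g '' S ∪ r.extend '' (insert 0 (insert 1 (T : Set ℝ)))) ?_
    (measure_union_null hgS (hfin.measure_zero _))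
  rintro _ ⟨t, rfl⟩
  by_cases ht : (t : ℝ) ∈ insert 0 (insert 1 (T : Set ℝ))
  · exact Or.inr ⟨t, ht, by simp⟩
  · simp only [mem_insert_iff, not_or] at ht
    refine Or.inl ⟨((t : ℝ) : ℂ), ⟨by simp, ⟨?_, ?_⟩, ?_⟩, by simp [hg]⟩
    · exact lt_of_le_of_ne t.2.1 (Ne.symm ht.1)
    · exact lt_of_le_of_ne t.2.2 ht.2.1
    · simpa using ht.2.2

/-! ### Winding numbers and the Cauchy integral -/

theorem integrableOn_ball_inv_norm :
    IntegrableOn (fun u : ℂ => ‖u‖⁻¹) (Metric.ball 0 1) := by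
  rw [integrableOn_fun_norm_addHaar (volume : Measure ℂ) (f := fun y : ℝ => y⁻¹)]
  refine (integrableOn_const (C := (1 : ℝ)) (by simp)).congr_fun (fun y hy => ?_) measurableSet_Ioo
  simp [finrank_real_complex, mul_inv_cancel₀ (ne_of_gt hy.1)]

/-- The convolution of `1 / |z|` with a continuous compactly supported function is bounded. -/
theorem exists_bound_integral_norm_div_sub {g : ℂ → ℂ} (hg : Continuous g)
    (hc : HasCompactSupport g) :
    ∃ C : ℝ, ∀ z, Integrable (fun w => g w / (w - z)) ∧ ∫ w, ‖g w / (w - z)‖ ≤ C := by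
  obtain ⟨M, hM⟩ := hc.exists_bound_of_continuous hg
  set k : ℂ → ℝ := (Metric.ball 0 1).indicator fun u => ‖u‖⁻¹
  have hk : Integrable k := integrableOn_ball_inv_norm.integrable_indicator measurableSet_ball
  have hgi : Integrable g := hg.integrable_of_hasCompactSupport hc
  have hM0 : 0 ≤ M := (norm_nonneg _).trans (hM 0)
  -- Within distance `1` of `z` the numerator is at most `M`; farther away the denominator is at
  -- least `1`. By translation invariance the integral of this majorant does not depend on `z`.
  have hb : ∀ z w, ‖g w / (w - z)‖ ≤ M * k (w - z) + ‖g w‖ := by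
    intro z w
    rw [norm_div, div_eq_mul_inv]
    by_cases h : w - z ∈ Metric.ball (0 : ℂ) 1
    · rw [show k (w - z) = ‖w - z‖⁻¹ from indicator_of_mem h _]
      have := mul_le_mul_of_nonneg_right (hM w) (inv_nonneg.2 (norm_nonneg (w - z)))
      linarith [norm_nonneg (g w)]
    · rw [show k (w - z) = 0 from indicator_of_notMem h _, mul_zero, zero_add]
      rw [mem_ball_zero_iff, not_lt] at h
      exact mul_le_of_le_one_right (norm_nonneg _) (inv_le_one_of_one_le₀ h)
  have hint : ∀ z, Integrable (fun w => M * k (w - z) + ‖g w‖) := fun z =>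
    ((hk.comp_sub_right z).const_mul M).add hgi.norm
  have hi : ∀ z, Integrable (fun w => g w / (w - z)) := fun z =>
    (hint z).mono' (hg.measurable.div (measurable_id.sub_const z)).aestronglyMeasurable
      (ae_of_all _ (hb z))
  refine ⟨M * (∫ u, k u) + ∫ w, ‖g w‖, fun z => ⟨hi z, ?_⟩⟩
  refine (integral_mono (hi z).norm (hint z) (hb z)).trans_eq ?_
  rw [integral_add ((hk.comp_sub_right z).const_mul M) hgi.norm, integral_const_mul,
    integral_sub_right_eq_self]

theorem windingNumber_eq {p : ℂ} (r : Path p p) (w : ℂ) :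
    2 * Real.pi * I * windingNumber r w =
      ∫ t in (0 : ℝ)..1, deriv r.extend t / (r.extend t - w) := by
  rw [windingNumber, mul_inv_cancel_left₀ two_pi_I_ne_zero,
    curveIntegral_eq_intervalIntegral_deriv]
  simp [div_eq_mul_inv]

/-- `∮ f dz = i ∫ (∂f/∂x + i ∂f/∂y) ind(r, ·) dx dy`. -/
theorem integral_mul_deriv_eq_integral_twoDbar {p : ℂ} {r : Path p p} (hr : IsPiecewiseC1 r)
    {f : ℂ → ℂ} (hf : ContDiff ℝ 1 f) (hc : HasCompactSupport f) :
    ∫ t in (0 : ℝ)..1, f (r.extend t) * deriv r.extend t =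
      I * ∫ w, twoDbar f w * windingNumber r w := by
  obtain ⟨K, hK0, hK⟩ := hr.exists_ae_deriv_bound
  obtain ⟨C, hC⟩ := exists_bound_integral_norm_div_sub (continuous_twoDbar hf)
    (hasCompactSupport_twoDbar hc)
  have hgm : Measurable (twoDbar f) := (continuous_twoDbar hf).measurable
  have hrm : Measurable r.extend := r.continuous_extend.measurable
  have hdm : Measurable (deriv r.extend) := measurable_deriv _
  -- Integrating `F` over `w` first gives Cauchy–Pompeiu at the point `r t`; integrating over `t`
  -- first gives the winding number about `w`. The bound `C`, uniform in the pole, together with the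
  -- bounded speed justifies Fubini.
  set F : ℝ × ℂ → ℂ := fun q => deriv r.extend q.1 * (twoDbar f q.2 / (q.2 - r.extend q.1))
  have hFm : Measurable F := by fun_prop
  have hF : Integrable F ((volume.restrict (Ioc (0 : ℝ) 1)).prod volume) := by
    rw [integrable_prod_iff hFm.aestronglyMeasurable]
    refine ⟨ae_of_all _ fun t => (hC (r.extend t)).1.const_mul (deriv r.extend t), ?_⟩
    refine Integrable.of_bound hFm.norm.stronglyMeasurable.integral_prod_right.aestronglyMeasurable
      (K * C) ?_
    filter_upwards [hK] with t ht
    simp only [F, norm_mul (deriv r.extend t), integral_const_mul]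
    have h0 : 0 ≤ ∫ w, ‖twoDbar f w / (w - r.extend t)‖ := integral_nonneg fun _ => norm_nonneg _
    rw [Real.norm_of_nonneg (mul_nonneg (norm_nonneg _) h0)]
    exact mul_le_mul ht (hC _).2 h0 hK0
  have h1 : ∀ t, ∫ w, F (t, w) = -(2 * Real.pi) * (f (r.extend t) * deriv r.extend t) := by
    intro t
    simp only [F]
    rw [integral_const_mul, integral_twoDbar_div hf hc]
    ring
  have h2 : ∀ w, ∫ t in Ioc (0 : ℝ) 1, F (t, w) =
      -(2 * Real.pi) * (I * (twoDbar f w * windingNumber r w)) := by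
    intro w
    have : ∀ t, F (t, w) = -twoDbar f w * (deriv r.extend t / (r.extend t - w)) := by
      intro t
      simp only [F]
      rw [← neg_sub (r.extend t) w, div_neg]
      ring
    simp only [this]
    rw [integral_const_mul, ← intervalIntegral.integral_of_le zero_le_one, ← windingNumber_eq]
    ring
  have hsw := integral_integral_swap (f := fun t w => F (t, w)) hF
  simp only [h1, h2, integral_const_mul] at hsw
  rw [intervalIntegral.integral_of_le zero_le_one]
  exact mul_left_cancel₀ (by simp [Real.pi_ne_zero]) hsw

/-- Only points of the curve escape the two winding conditions, and the curve is null. -/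
theorem integral_mul_windingNumber {D : Set ℂ} {p : ℂ} {r : Path p p} (h : IsJordanDomain D r)
    (g : ℂ → ℂ) : ∫ w, g w * windingNumber r w = ∫ w in D, g w := by
  rw [← integral_indicator h.isOpen.measurableSet]
  refine integral_congr_ae ?_
  have hn : ∀ᵐ w, w ∉ range r := measure_eq_zero_iff_ae_notMem.1 h.piecewise.volume_range
  filter_upwards [hn] with w hw
  rw [h.range_eq, frontier, h.isOpen.interior_eq] at hw
  by_cases hD : w ∈ D
  · simp [hD, h.winding_inside w hD]
  · have : w ∉ closure D := fun hcl => hw ⟨hcl, hD⟩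
    simp [hD, h.winding_outside w this]

theorem IsPiecewiseC1.intervalIntegrable_mul_deriv {p q : ℂ} {r : Path p q} (hr : IsPiecewiseC1 r)
    {f : ℂ → ℂ} (hf : Continuous f) :
    IntervalIntegrable (fun t => f (r.extend t) * deriv r.extend t) volume 0 1 := by
  obtain ⟨K, hK0, hK⟩ := hr.exists_ae_deriv_bound
  rw [intervalIntegrable_iff_integrableOn_Ioc_of_le zero_le_one]
  obtain ⟨M, hM⟩ := isCompact_Icc.exists_bound_of_continuousOn (s := Icc (0 : ℝ) 1)
    (hf.comp r.continuous_extend).continuousOn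
  refine Integrable.of_bound ((hf.comp r.continuous_extend).measurable.mul
    (measurable_deriv _)).aestronglyMeasurable (M * K) ?_
  filter_upwards [hK, ae_restrict_mem measurableSet_Ioc] with t ht htm
  rw [norm_mul]
  have h1 := hM t (Ioc_subset_Icc_self htm)
  exact mul_le_mul h1 ht (norm_nonneg _) ((norm_nonneg _).trans h1)

/-! ### Green's theorem in divergence form -/

/-- Green's theorem, in divergence form, for compactly supported fields. -/
theorem IsJordanDomain.green_of_hasCompactSupport {D : Set ℂ} {p : ℂ} {r : Path p p}
    (h : IsJordanDomain D r) {u v : ℂ → ℂ} (hu : ContDiff ℝ 1 u) (huc : HasCompactSupport u)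
    (hv : ContDiff ℝ 1 v) (hvc : HasCompactSupport v) :
    ∫ t in (0 : ℝ)..1, (u (r.extend t) * (deriv r.extend t).im -
        v (r.extend t) * (deriv r.extend t).re) =
      ∫ w in D, (fderiv ℝ u w 1 + fderiv ℝ v w I) := by
  -- Substituting `dy = (dz - dz̄) / 2i` and `dx = (dz + dz̄) / 2` gives `u dy - v dx = f₁ dz + conj
  -- (f₂ dz)`, so the formula for `∮ f dz` applies to both terms.
  set f₁ : ℂ → ℂ := fun z => (-I / 2) * u z - (1 / 2) * v z with hf₁
  set f₂ : ℂ → ℂ := fun z => (-I / 2) * conj (u z) - (1 / 2) * conj (v z) with hf₂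
  have hcu : ContDiff ℝ 1 fun z => conj (u z) := conjCLE.contDiff.comp hu
  have hcv : ContDiff ℝ 1 fun z => conj (v z) := conjCLE.contDiff.comp hv
  have h₁ : ContDiff ℝ 1 f₁ := (contDiff_const.mul hu).sub (contDiff_const.mul hv)
  have h₂ : ContDiff ℝ 1 f₂ := (contDiff_const.mul hcu).sub (contDiff_const.mul hcv)
  have hc₁ : HasCompactSupport f₁ := (huc.mul_left (f := fun _ => -I / 2)).sub
    (hvc.mul_left (f := fun _ => 1 / 2))
  have hc₂ : HasCompactSupport f₂ :=
    ((huc.comp_left (g := conj) (map_zero _)).mul_left (f := fun _ => -I / 2)).sub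
      ((hvc.comp_left (g := conj) (map_zero _)).mul_left (f := fun _ => 1 / 2))
  have e₁ := integral_mul_deriv_eq_integral_twoDbar h.piecewise h₁ hc₁
  have e₂ := congrArg conj (integral_mul_deriv_eq_integral_twoDbar h.piecewise h₂ hc₂)
  rw [integral_mul_windingNumber h] at e₁ e₂
  rw [map_mul, ← integral_conj, intervalIntegral.integral_of_le zero_le_one, ← integral_conj,
    ← intervalIntegral.integral_of_le zero_le_one] at e₂
  have i₁ := h.piecewise.intervalIntegrable_mul_deriv h₁.continuous
  have i₂ : IntervalIntegrable (fun t => conj (f₂ (r.extend t) * deriv r.extend t)) volume 0 1 := by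
    have := h.piecewise.intervalIntegrable_mul_deriv h₂.continuous
    exact ⟨conjCLE.integrable_comp_iff.2 this.1, conjCLE.integrable_comp_iff.2 this.2⟩
  have hpt : ∀ t, u (r.extend t) * (deriv r.extend t).im - v (r.extend t) * (deriv r.extend t).re =
      f₁ (r.extend t) * deriv r.extend t + conj (f₂ (r.extend t) * deriv r.extend t) := by
    intro t
    generalize r.extend t = z
    generalize deriv r.extend t = d
    have hd : conj d = d.re - d.im * I := by
      apply Complex.ext <;> simp
    have hd' : d = d.re + d.im * I := (re_add_im d).symm
    simp only [hf₁, hf₂, map_mul, map_sub, conj_conj, map_div₀, map_neg, conj_I, map_one,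
      map_ofNat, hd]
    generalize d.re = x at *
    generalize d.im = y at *
    subst hd'
    linear_combination (u z * y) * I_mul_I
  have hd₁ : ∀ w, twoDbar f₁ w = (-I / 2) * twoDbar u w - (1 / 2) * twoDbar v w := by
    intro w
    have := ((hu.differentiable one_ne_zero w).hasFDerivAt.const_mul (-I / 2)).sub
      ((hv.differentiable one_ne_zero w).hasFDerivAt.const_mul (1 / 2))
    rw [twoDbar, show fderiv ℝ f₁ w = _ from this.fderiv]
    simp only [twoDbar, sub_apply, smul_apply, smul_eq_mul]
    ring
  have hd₂ : ∀ w, conj (twoDbar f₂ w) = (I / 2) * (fderiv ℝ u w 1 - I * fderiv ℝ u w I) -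
      (1 / 2) * (fderiv ℝ v w 1 - I * fderiv ℝ v w I) := by
    intro w
    have := ((conjCLE.hasFDerivAt.comp w
        (hu.differentiable one_ne_zero w).hasFDerivAt).const_mul (-I / 2)).sub
      ((conjCLE.hasFDerivAt.comp w
        (hv.differentiable one_ne_zero w).hasFDerivAt).const_mul (1 / 2))
    rw [twoDbar, show fderiv ℝ f₂ w = _ from this.fderiv]
    simp
    simp only [map_ofNat]
    ring
  simp only [hpt]
  rw [intervalIntegral.integral_add i₁ i₂, e₁, e₂, ← integral_const_mul, ← integral_const_mul,
    ← integral_add]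
  · refine integral_congr_ae (ae_of_all _ fun w => ?_)
    beta_reduce
    rw [hd₁, hd₂, twoDbar, twoDbar, conj_I]
    generalize fderiv ℝ u w 1 = ux
    generalize fderiv ℝ u w I = uy
    generalize fderiv ℝ v w 1 = vx
    generalize fderiv ℝ v w I = vy
    linear_combination (-ux - vy) * I_mul_I
  · exact (((continuous_twoDbar h₁).integrable_of_hasCompactSupport
      (hasCompactSupport_twoDbar hc₁)).const_mul I).integrableOn
  · exact ((conjCLE.integrable_comp_iff.2 ((continuous_twoDbar h₂).integrable_of_hasCompactSupport
      (hasCompactSupport_twoDbar hc₂))).const_mul (conj I)).integrableOn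

/-- The value `1` is taken on a neighbourhood of `K`, so that multiplying by `χ` changes neither
values nor derivatives at points of `K`. -/
theorem exists_cutoff {K N : Set ℂ} (hK : IsCompact K) (hN : IsOpen N) (hKN : K ⊆ N) :
    ∃ χ : ℂ → ℝ, ContDiff ℝ 1 χ ∧ (∀ᶠ z in 𝓝ˢ K, χ z = 1) ∧ HasCompactSupport χ ∧
      tsupport χ ⊆ N := by
  obtain ⟨L, hL, hKL, hLN⟩ := exists_compact_between hK hN hKN
  obtain ⟨χ, h1, h0, -⟩ := exists_contMDiffMap_one_nhds_of_subset_interior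
    (modelWithCornersSelf ℝ ℂ) (n := 1) hK.isClosed hKL
  have hsub : tsupport χ ⊆ L := closure_minimal
    (fun z hz => by_contra fun h => hz (h0 z h)) hL.isClosed
  exact ⟨χ, χ.contMDiff.contDiff, h1, hL.of_isClosed_subset (isClosed_tsupport _) hsub,
    hsub.trans hLN⟩

theorem contDiff_cutoff_mul {N : Set ℂ} (hN : IsOpen N) {χ : ℂ → ℝ} (hχ : ContDiff ℝ 1 χ)
    (hs : tsupport χ ⊆ N) {u : ℂ → ℂ} (hu : ContDiffOn ℝ 1 u N) :
    ContDiff ℝ 1 fun z => χ z • u z := by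
  refine contDiff_of_contDiffOn_union_of_isOpen (s := N) (t := (tsupport χ)ᶜ) ?_ ?_ ?_ hN
    (isClosed_tsupport χ).isOpen_compl
  · exact hχ.contDiffOn.smul hu
  · exact contDiffOn_const (c := 0) |>.congr fun z hz => by
      rw [image_eq_zero_of_notMem_tsupport hz, zero_smul]
  · exact eq_univ_of_forall fun z => (em (z ∈ tsupport χ)).imp (fun hz => hs hz) id

theorem IsJordanDomain.extend_mem_closure {D : Set ℂ} {p : ℂ} {r : Path p p}
    (h : IsJordanDomain D r) (t : ℝ) : r.extend t ∈ closure D := by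
  have : r.extend t ∈ range r := by
    rw [← r.extend_range]; exact mem_range_self t
  rw [h.range_eq] at this
  exact frontier_subset_closure this

/-- Green's theorem, in divergence form, for fields that are `C¹` around the closed domain. -/
theorem IsJordanDomain.green_of_contDiffOn {D : Set ℂ} {p : ℂ} {r : Path p p}
    (h : IsJordanDomain D r) {N : Set ℂ} (hN : IsOpen N) (hDN : closure D ⊆ N) {u v : ℂ → ℂ}
    (hu : ContDiffOn ℝ 1 u N) (hv : ContDiffOn ℝ 1 v N) :
    ∫ t in (0 : ℝ)..1, (u (r.extend t) * (deriv r.extend t).im -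
        v (r.extend t) * (deriv r.extend t).re) =
      ∫ w in D, (fderiv ℝ u w 1 + fderiv ℝ v w I) := by
  obtain ⟨χ, hχ, h1, hc, hs⟩ := exists_cutoff h.bounded.isCompact_closure hN hDN
  have key := h.green_of_hasCompactSupport (contDiff_cutoff_mul hN hχ hs hu) hc.smul_right
    (contDiff_cutoff_mul hN hχ hs hv) hc.smul_right
  have heq : ∀ (g : ℂ → ℂ), ∀ w ∈ closure D, (fun z => χ z • g z) =ᶠ[𝓝 w] g := by
    intro g w hw
    filter_upwards [h1.filter_mono (nhds_le_nhdsSet hw)] with z hz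
    rw [hz, one_smul]
  have hb := fun g t => (heq g _ (h.extend_mem_closure t)).eq_of_nhds
  simp only [hb] at key
  rw [key]
  refine setIntegral_congr_fun h.isOpen.measurableSet fun w hw => ?_
  rw [(heq u w (subset_closure hw)).fderiv_eq, (heq v w (subset_closure hw)).fderiv_eq]

/-- Green's theorem, in divergence form, for fields that are continuous on a compact convex set
containing the closed domain, and `C¹` with bounded divergence in its interior. -/
theorem IsJordanDomain.green_of_convex {D : Set ℂ} {p : ℂ} {r : Path p p}
    (h : IsJordanDomain D r) {K : Set ℂ} (hK : Convex ℝ K) (hKc : IsCompact K)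
    (hne : (interior K).Nonempty) (hDK : closure D ⊆ K) {u v : ℂ → ℂ}
    (hu : ContinuousOn u K) (hv : ContinuousOn v K)
    (hu' : ContDiffOn ℝ 1 u (interior K)) (hv' : ContDiffOn ℝ 1 v (interior K)) {M : ℝ}
    (hM : ∀ z ∈ interior K, ‖fderiv ℝ u z 1 + fderiv ℝ v z I‖ ≤ M) :
    ∫ t in (0 : ℝ)..1, (u (r.extend t) * (deriv r.extend t).im -
        v (r.extend t) * (deriv r.extend t).re) =
      ∫ w in D, (fderiv ℝ u w 1 + fderiv ℝ v w I) := by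
  obtain ⟨c, hc⟩ := hne
  set τ : ℕ → ℝ := fun n => (n : ℝ) / (n + 1) with hτ
  have hτ0 : ∀ n, 0 ≤ τ n := fun n => by positivity
  have hτ1 : ∀ n, τ n < 1 := fun n => by
    rw [hτ, div_lt_one (by positivity)]; linarith
  have hτlim : Filter.Tendsto τ Filter.atTop (𝓝 1) := tendsto_natCast_div_add_atTop 1
  -- The homothety centred at `c` with ratio `τ n < 1` maps the convex set `K` into its interior. So
  -- `u ∘ m n` and `v ∘ m n` are `C¹` on a neighbourhood of the closed domain, and `m n` tends to
  -- the identity.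
  set m : ℕ → ℂ → ℂ := fun n z => (1 - τ n) • c + τ n • z with hm
  have hmd : ∀ n, ContDiff ℝ 1 (m n) := fun n => contDiff_const.add (contDiff_id.const_smul _)
  have hmK : ∀ n, ∀ z ∈ K, m n z ∈ interior K := fun n z hz =>
    hK.combo_interior_self_mem_interior hc hz (by linarith [hτ1 n]) (hτ0 n) (by ring)
  have hmlim : ∀ z, Filter.Tendsto (fun n => m n z) Filter.atTop (𝓝 z) := fun z => by
    have : Filter.Tendsto (fun n => m n z) Filter.atTop (𝓝 ((1 - (1 : ℝ)) • c + (1 : ℝ) • z)) :=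
      ((hτlim.const_sub 1).smul_const c).add (hτlim.smul_const z)
    simpa using this
  have hDi : D ⊆ interior K := interior_maximal (subset_closure.trans hDK) h.isOpen
  have hrK : ∀ t, r.extend t ∈ K := fun t => hDK (h.extend_mem_closure t)
  have hgreen : ∀ n, ∫ t in Ioc (0 : ℝ) 1, (u (m n (r.extend t)) * (deriv r.extend t).im -
        v (m n (r.extend t)) * (deriv r.extend t).re) =
      ∫ w in D, (τ n : ℂ) * (fderiv ℝ u (m n w) 1 + fderiv ℝ v (m n w) I) := by
    intro n
    have hN : IsOpen (m n ⁻¹' interior K) := isOpen_interior.preimage (hmd n).continuous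
    have := h.green_of_contDiffOn hN (fun z hz => hmK n z (hDK hz))
      (hu'.comp (hmd n).contDiffOn fun z hz => hz) (hv'.comp (hmd n).contDiffOn fun z hz => hz)
    rw [intervalIntegral.integral_of_le zero_le_one] at this
    refine this.trans (setIntegral_congr_fun h.isOpen.measurableSet fun w hw => ?_)
    have hw' := hmK n w (interior_subset (hDi hw))
    have hder : ∀ {g : ℂ → ℂ}, ContDiffOn ℝ 1 g (interior K) → ∀ x : ℂ,
        fderiv ℝ (g ∘ m n) w x = τ n * fderiv ℝ g (m n w) x := by
      intro g hg x
      have hgd : DifferentiableAt ℝ g (m n w) :=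
        (hg.differentiableOn one_ne_zero).differentiableAt (isOpen_interior.mem_nhds hw')
      have hmw : HasFDerivAt (m n) (τ n • ContinuousLinearMap.id ℝ ℂ) w :=
        ((hasFDerivAt_id w).const_smul (τ n)).const_add _
      rw [(hgd.hasFDerivAt.comp w hmw).fderiv]
      simp
    rw [hder hu', hder hv', mul_add]
  obtain ⟨Mu, hMu⟩ := hKc.exists_bound_of_continuousOn hu
  obtain ⟨Mv, hMv⟩ := hKc.exists_bound_of_continuousOn hv
  obtain ⟨C, hC0, hC⟩ := h.piecewise.exists_ae_deriv_bound
  have hlim₁ : Filter.Tendsto (fun n => ∫ t in Ioc (0 : ℝ) 1,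
      (u (m n (r.extend t)) * (deriv r.extend t).im - v (m n (r.extend t)) * (deriv r.extend t).re))
      Filter.atTop (𝓝 (∫ t in Ioc (0 : ℝ) 1, (u (r.extend t) * (deriv r.extend t).im -
        v (r.extend t) * (deriv r.extend t).re))) := by
    refine tendsto_integral_of_dominated_convergence (fun _ => Mu * C + Mv * C) (fun n => ?_)
      (integrable_const _) (fun n => ?_) (ae_of_all _ fun t => ?_)
    · have hcont : ∀ {g : ℂ → ℂ}, ContinuousOn g K → Continuous fun t => g (m n (r.extend t)) :=
        fun hg => hg.comp_continuous ((hmd n).continuous.comp r.continuous_extend)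
          fun t => interior_subset (hmK n _ (hrK t))
      have hdm : Measurable (deriv r.extend) := measurable_deriv _
      have h1 := (hcont hu).measurable
      have h2 := (hcont hv).measurable
      exact ((h1.mul (measurable_ofReal.comp (measurable_im.comp hdm))).sub
        (h2.mul (measurable_ofReal.comp (measurable_re.comp hdm)))).aestronglyMeasurable
    · filter_upwards [hC] with t ht
      have hmt := interior_subset (hmK n _ (hrK t))
      refine (norm_sub_le _ _).trans (add_le_add ?_ ?_)
      · rw [norm_mul, norm_real]
        exact mul_le_mul (hMu _ hmt) ((abs_im_le_norm _).trans ht) (norm_nonneg _)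
          ((norm_nonneg _).trans (hMu _ hmt))
      · rw [norm_mul, norm_real]
        exact mul_le_mul (hMv _ hmt) ((abs_re_le_norm _).trans ht) (norm_nonneg _)
          ((norm_nonneg _).trans (hMv _ hmt))
    · have hw : Filter.Tendsto (fun n => m n (r.extend t)) Filter.atTop (𝓝[K] (r.extend t)) :=
        tendsto_nhdsWithin_iff.2 ⟨hmlim _,
          Filter.Eventually.of_forall fun n => interior_subset (hmK n _ (hrK t))⟩
      exact (((hu _ (hrK t)).tendsto.comp hw).mul_const _).sub
        (((hv _ (hrK t)).tendsto.comp hw).mul_const _)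
  have hdivc : ContinuousOn (fun z => fderiv ℝ u z 1 + fderiv ℝ v z I) (interior K) :=
    ((hu'.continuousOn_fderiv_of_isOpen isOpen_interior le_rfl).clm_apply continuousOn_const).add
      ((hv'.continuousOn_fderiv_of_isOpen isOpen_interior le_rfl).clm_apply continuousOn_const)
  -- Derivatives of `u` and `v` separately may blow up at the boundary of `K`; only the bound `M` on
  -- the divergence is needed for dominated convergence.
  have hlim₂ : Filter.Tendsto (fun n => ∫ w in D,
      (τ n : ℂ) * (fderiv ℝ u (m n w) 1 + fderiv ℝ v (m n w) I)) Filter.atTop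
      (𝓝 (∫ w in D, (fderiv ℝ u w 1 + fderiv ℝ v w I))) := by
    have hfin : IsFiniteMeasure (volume.restrict D) :=
      isFiniteMeasure_restrict.2 h.bounded.measure_lt_top.ne
    refine tendsto_integral_of_dominated_convergence (fun _ => M) (fun n => ?_)
      (integrable_const _) (fun n => ?_) ?_
    · refine ContinuousOn.aestronglyMeasurable (continuousOn_const.mul ?_) h.isOpen.measurableSet
      exact hdivc.comp (hmd n).continuous.continuousOn
        fun w hw => hmK n w (interior_subset (hDi hw))
    · filter_upwards [ae_restrict_mem h.isOpen.measurableSet] with w hw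
      rw [norm_mul, norm_real, Real.norm_of_nonneg (hτ0 n)]
      exact (mul_le_of_le_one_left (norm_nonneg _) (hτ1 n).le).trans
        (hM _ (hmK n w (interior_subset (hDi hw))))
    · filter_upwards [ae_restrict_mem h.isOpen.measurableSet] with w hw
      have h1 := ((hdivc w (hDi hw)).continuousAt (isOpen_interior.mem_nhds (hDi hw))).tendsto.comp
        (hmlim w)
      have h2 : Filter.Tendsto (fun n => (τ n : ℂ)) Filter.atTop (𝓝 ((1 : ℝ) : ℂ)) :=
        (continuous_ofReal.tendsto 1).comp hτlim
      simpa using h2.mul h1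
  rw [intervalIntegral.integral_of_le zero_le_one]
  refine tendsto_nhds_unique hlim₁ ?_
  simp only [hgreen]
  exact hlim₂

/-! ### The integrating factor `e^λ` and the form `rhoForm` -/

theorem curveIntegral_rhoForm {p q : ℂ} (r : Path p q) (θ φ h : ℂ → ℂ) :
    ∫ᶜ z in r, rhoForm θ φ h z =
      ∫ t in (0 : ℝ)..1, ((h * θ) (r.extend t) * (deriv r.extend t).im -
        (h * φ) (r.extend t) * (deriv r.extend t).re) := by
  rw [curveIntegral_eq_intervalIntegral_deriv]
  congr 1
  ext t
  simp [rhoForm]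
  ring

/-- `G` is not assumed differentiable and `L` has only a directional derivative. Writing `G = e^{-L}
h` with `h` differentiable shows that `G` has a line derivative along `v`, after which the product
rule applies. -/
theorem fderiv_exp_mul_apply {L : ℂ → ℝ} {G : ℂ → ℂ} {z v : ℂ}
    (hL : LineDifferentiableAt ℝ L z v)
    (hd : DifferentiableAt ℝ (fun w => (Real.exp (L w) : ℂ) * G w) z) :
    fderiv ℝ (fun w => (Real.exp (L w) : ℂ) * G w) z v =
      Real.exp (L z) * (lineDeriv ℝ (fun w => (L w : ℂ)) z v * G z + lineDeriv ℝ G z v) := by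
  set h : ℂ → ℂ := fun w => (Real.exp (L w) : ℂ) * G w with hh
  have hG : ∀ w, G w = (Real.exp (-L w) : ℂ) * h w := by
    intro w
    rw [hh, ← mul_assoc, ← ofReal_mul, ← Real.exp_add, neg_add_cancel, Real.exp_zero, ofReal_one,
      one_mul]
  have h1 : HasLineDerivAt ℝ h (fderiv ℝ h z v) z v := hd.hasFDerivAt.hasLineDerivAt v
  have h2 : HasLineDerivAt ℝ L (lineDeriv ℝ L z v) z v := hL.hasLineDerivAt
  have h3 : HasLineDerivAt ℝ (fun w => (L w : ℂ)) ((lineDeriv ℝ L z v : ℝ) : ℂ) z v :=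
    HasDerivAt.ofReal_comp h2
  have h4 : HasLineDerivAt ℝ G
      ((Real.exp (-L z) * -lineDeriv ℝ L z v : ℝ) * h z + Real.exp (-L z) * fderiv ℝ h z v) z v := by
    have e1 : HasDerivAt (fun t : ℝ => ((Real.exp (-L (z + t • v)) : ℝ) : ℂ))
        ((Real.exp (-L (z + (0 : ℝ) • v)) * -lineDeriv ℝ L z v : ℝ) : ℂ) 0 :=
      (HasDerivAt.neg h2).exp.ofReal_comp
    have e2 := HasDerivAt.mul e1 h1
    simp only [zero_smul, add_zero] at e2
    refine e2.congr_of_eventuallyEq (Filter.Eventually.of_forall fun t => hG _)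
  rw [h3.lineDeriv, h4.lineDeriv, hG z]
  have : (Real.exp (L z) : ℂ) * Real.exp (-L z) = 1 := by
    rw [← ofReal_mul, ← Real.exp_add, add_neg_cancel, Real.exp_zero, ofReal_one]
  push_cast at this ⊢
  linear_combination (-(fderiv ℝ h z v)) * this

theorem pdX_re {f : ℂ → ℂ} {z : ℂ} (hf : DifferentiableAt ℝ f z) :
    pdX (fun u => (f u).re) z = (fderiv ℝ f z 1).re :=
  ((reCLM.hasFDerivAt.comp z hf.hasFDerivAt).hasLineDerivAt 1).lineDeriv

theorem pdX_im {f : ℂ → ℂ} {z : ℂ} (hf : DifferentiableAt ℝ f z) :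
    pdX (fun u => (f u).im) z = (fderiv ℝ f z 1).im :=
  ((imCLM.hasFDerivAt.comp z hf.hasFDerivAt).hasLineDerivAt 1).lineDeriv

theorem pdY_re {f : ℂ → ℂ} {z : ℂ} (hf : DifferentiableAt ℝ f z) :
    pdY (fun u => (f u).re) z = (fderiv ℝ f z I).re :=
  ((reCLM.hasFDerivAt.comp z hf.hasFDerivAt).hasLineDerivAt I).lineDeriv

theorem pdY_im {f : ℂ → ℂ} {z : ℂ} (hf : DifferentiableAt ℝ f z) :
    pdY (fun u => (f u).im) z = (fderiv ℝ f z I).im :=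
  ((imCLM.hasFDerivAt.comp z hf.hasFDerivAt).hasLineDerivAt I).lineDeriv

/-- Green's theorem for `h dρ_{θφ}`, where `h` is annihilated by `θ ∂/∂x + φ ∂/∂y` in the interior
of a compact convex set containing the closed domain. -/
theorem IsJordanDomain.curveIntegral_rhoForm_eq {D : Set ℂ} {p : ℂ} {r : Path p p}
    (hD : IsJordanDomain D r) {K : Set ℂ} (hK : Convex ℝ K) (hKc : IsCompact K)
    (hne : (interior K).Nonempty) (hDK : closure D ⊆ K) {θ φ h : ℂ → ℂ} (hθ : ContDiff ℝ 1 θ)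
    (hφ : ContDiff ℝ 1 φ) (hc : ContinuousOn h K) (hd : ContDiffOn ℝ 1 h (interior K))
    (hker : ∀ z ∈ interior K, θ z * fderiv ℝ h z 1 + φ z * fderiv ℝ h z I = 0) :
    ∫ᶜ z in r, rhoForm θ φ h z = ∫ w in D, h w * (fderiv ℝ θ w 1 + fderiv ℝ φ w I) := by
  have hdiv : ∀ z ∈ interior K, fderiv ℝ (h * θ) z 1 + fderiv ℝ (h * φ) z I =
      h z * (fderiv ℝ θ z 1 + fderiv ℝ φ z I) := by
    intro z hz
    have h1 : DifferentiableAt ℝ h z :=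
      (hd.differentiableOn one_ne_zero).differentiableAt (isOpen_interior.mem_nhds hz)
    rw [fderiv_mul h1 (hθ.differentiable one_ne_zero z),
      fderiv_mul h1 (hφ.differentiable one_ne_zero z)]
    simp only [add_apply, smul_apply, smul_eq_mul]
    linear_combination hker z hz
  have hθc := hθ.continuous_fderiv one_ne_zero
  have hφc := hφ.continuous_fderiv one_ne_zero
  -- The divergence coincides in the interior with a function continuous on all of the compact set
  -- `K`, which supplies the bound needed for the limit.
  obtain ⟨M, hM⟩ := hKc.exists_bound_of_continuousOn (f := fun z =>
    h z * (fderiv ℝ θ z 1 + fderiv ℝ φ z I)) (hc.mul (by fun_prop))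
  rw [curveIntegral_rhoForm, hD.green_of_convex hK hKc hne hDK (hc.mul hθ.continuous.continuousOn)
    (hc.mul hφ.continuous.continuousOn) (hd.mul hθ.contDiffOn) (hd.mul hφ.contDiffOn)
    (fun z hz => (hdiv z hz).symm ▸ hM z (interior_subset hz))]
  exact setIntegral_congr_fun hD.isOpen.measurableSet fun w hw =>
    hdiv w (interior_maximal (subset_closure.trans hDK) hD.isOpen hw)

/-- One idempotent component of the corollary, with `E` in the role of `Dφ` and `s` in that of `σ`.
The two equations combine to say that `θ ∂/∂x + φ ∂/∂y` annihilates `e^L G`. -/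
theorem curveIntegral_rhoForm_exp_mul_eq {D : Set ℂ} {p : ℂ} {r : Path p p}
    (hD : IsJordanDomain D r) {K : Set ℂ} (hK : Convex ℝ K) (hKc : IsCompact K)
    (hne : (interior K).Nonempty) (hDK : closure D ⊆ K) {θ φ G E : ℂ → ℂ} {L : ℂ → ℝ} {s : ℂ}
    (hs : s ≠ 0) (hE : ∀ z ∈ interior K, E z ≠ 0)
    (hθ : ContDiff ℝ 1 θ) (hφ : ContDiff ℝ 1 φ)
    (hL : ∀ z ∈ interior K, LineDifferentiableAt ℝ L z 1 ∧ LineDifferentiableAt ℝ L z I)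
    (hLeq : ∀ z ∈ interior K, θ z * pdX (fun w => (L w : ℂ)) z + φ z * pdY (fun w => (L w : ℂ)) z =
      E z * s⁻¹ * (1 - s))
    (hker : ∀ z ∈ interior K, (1 - s) * G z + s * ((θ z * pdX G z + φ z * pdY G z) / E z) = 0)
    (hc : ContinuousOn (fun z => (Real.exp (L z) : ℂ) * G z) K)
    (hd : ContDiffOn ℝ 1 (fun z => (Real.exp (L z) : ℂ) * G z) (interior K)) :
    ∫ᶜ z in r, rhoForm θ φ (fun z => (Real.exp (L z) : ℂ) * G z) z =
      I / 2 * wedgeIntegral D (fun z =>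
        ((pdX (fun u => (θ u).re) z + pdY (fun u => (φ u).re) z : ℝ) : ℂ) *
            ((Real.exp (L z) : ℂ) * G z) +
          ((pdX (fun u => (θ u).im) z + pdY (fun u => (φ u).im) z : ℝ) : ℂ) * I *
            ((Real.exp (L z) : ℂ) * G z)) := by
  have hker' : ∀ z ∈ interior K,
      θ z * fderiv ℝ (fun z => (Real.exp (L z) : ℂ) * G z) z 1 +
        φ z * fderiv ℝ (fun z => (Real.exp (L z) : ℂ) * G z) z I = 0 := by
    intro z hz
    have h1 : DifferentiableAt ℝ (fun z => (Real.exp (L z) : ℂ) * G z) z :=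
      (hd.differentiableOn one_ne_zero).differentiableAt (isOpen_interior.mem_nhds hz)
    rw [fderiv_exp_mul_apply (hL z hz).1 h1, fderiv_exp_mul_apply (hL z hz).2 h1]
    have e1 := hLeq z hz
    have e2 := hker z hz
    have hE' := hE z hz
    rw [pdX, pdY] at e1 e2
    field_simp at e1 e2
    refine mul_left_cancel₀ hs ?_
    linear_combination Real.exp (L z) * G z * e1 + Real.exp (L z) * e2
  rw [hD.curveIntegral_rhoForm_eq hK hKc hne hDK hθ hφ hc hd hker', wedgeIntegral, ← mul_assoc,
    show I / 2 * (-2 * I) = 1 by linear_combination -I_mul_I, one_mul]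
  congr 1
  ext w
  have h1 := hθ.differentiable one_ne_zero w
  have h2 := hφ.differentiable one_ne_zero w
  rw [pdX_re h1, pdX_im h1, pdY_re h2, pdY_im h2]
  conv_lhs => rw [← re_add_im (fderiv ℝ θ w 1), ← re_add_im (fderiv ℝ φ w I)]
  push_cast
  ring

/-! ### Geometry of the box and positivity of `Dφ` -/

theorem convex_boxFst (P Q : Fin 4 → ℝ) : Convex ℝ (boxFst P Q) :=
  ((convex_Icc _ _).linear_preimage reLm).inter ((convex_Icc _ _).linear_preimage imLm)

theorem convex_boxSnd (P Q : Fin 4 → ℝ) : Convex ℝ (boxSnd P Q) :=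
  ((convex_Icc _ _).linear_preimage reLm).inter ((convex_Icc _ _).linear_preimage imLm)

theorem isCompact_boxFst (P Q : Fin 4 → ℝ) : IsCompact (boxFst P Q) :=
  isCompact_Icc.reProdIm isCompact_Icc

theorem isCompact_boxSnd (P Q : Fin 4 → ℝ) : IsCompact (boxSnd P Q) :=
  isCompact_Icc.reProdIm isCompact_Icc

theorem interior_reProdIm_Icc_nonempty {a b c d : ℝ} (h₁ : a < b) (h₂ : c < d) :
    (interior (Icc a b ×ℂ Icc c d)).Nonempty := by
  rw [interior_reProdIm, interior_Icc, interior_Icc]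
  exact ⟨⟨(a + b) / 2, (c + d) / 2⟩, ⟨by simp; linarith, by simp; linarith⟩,
    ⟨by simp; linarith, by simp; linarith⟩⟩

theorem pdX_add_pdY_pos {f : ℂ → ℝ} {K : Set ℂ} {z : ℂ} (hz : z ∈ interior K)
    (h : 0 < lineDerivWithin ℝ f K z 1 ∧ 0 < lineDerivWithin ℝ f K z I) :
    0 < pdX f z + pdY f z := by
  rw [lineDerivWithin_of_mem_nhds (mem_interior_iff_mem_nhds.1 hz),
    lineDerivWithin_of_mem_nhds (mem_interior_iff_mem_nhds.1 hz)] at h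
  exact add_pos h.1 h.2

end BicomplexWeighted

/-! ### Assembling the two components -/

open BicomplexWeighted in
theorem mainTheorem5
    (P Q : Fin 4 → ℝ) (hPQ : ∀ k, P k < Q k)
    (α σ : Fin 4 → ℝ) (hα : ∀ k, α k ∈ Set.Ioo (0 : ℝ) 1) (hσ : ∀ k, σ k ∈ Set.Ioo (0 : ℝ) 1)
    -- the weights `ϑ`, `φ`
    (th vphi : ProductFun ℂ)
    (hth : ContDiff ℝ 1 th.1 ∧ ContDiff ℝ 1 th.2)
    (hvphi : ContDiff ℝ 1 vphi.1 ∧ ContDiff ℝ 1 vphi.2)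
    -- the hyperbolic-valued function with respect to which one integrates
    (phi : ProductFun ℝ)
    (hphi : ContDiffOn ℝ 1 phi.1 (boxFst P Q) ∧ ContDiffOn ℝ 1 phi.2 (boxSnd P Q))
    (hphi_nonneg : (∀ z ∈ boxFst P Q, 0 ≤ phi.1 z) ∧ (∀ z ∈ boxSnd P Q, 0 ≤ phi.2 z))
    (hphi_pos₁ : ∀ z ∈ boxFst P Q, 0 < lineDerivWithin ℝ phi.1 (boxFst P Q) z 1 ∧
      0 < lineDerivWithin ℝ phi.1 (boxFst P Q) z Complex.I)
    (hphi_pos₂ : ∀ z ∈ boxSnd P Q, 0 < lineDerivWithin ℝ phi.2 (boxSnd P Q) z 1 ∧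
      0 < lineDerivWithin ℝ phi.2 (boxSnd P Q) z Complex.I)
    -- the real functions `λ₁`, `λ₂`
    (lam : ProductFun ℝ)
    (hlam_diff₁ : ∀ z ∈ interior (boxFst P Q),
      LineDifferentiableAt ℝ lam.1 z 1 ∧ LineDifferentiableAt ℝ lam.1 z Complex.I)
    (hlam_diff₂ : ∀ z ∈ interior (boxSnd P Q),
      LineDifferentiableAt ℝ lam.2 z 1 ∧ LineDifferentiableAt ℝ lam.2 z Complex.I)
    (hlam : ∀ Z ∈ interior (box P Q),
      bcEval (weightedCR th vphi (bcOfReal lam)) Z =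
        bcEval (sumPartials phi) Z * (bcSigma σ)⁻¹ * (1 - bcSigma σ))
    (W : BC) (hW : W ∈ box P Q)
    (F : ProductFun ℂ) (hF : IsAC1 P Q W F)
    (hFcont : ContinuousOn (bcEval (bcExp lam * bcFracInt P α σ phi F W)) (box P Q))
    (hFC1 : ContDiffOn ℝ 1 (bcEval (bcExp lam * bcFracInt P α σ phi F W)) (interior (box P Q)))
    (S : Surface) (hS : S.carrier ⊆ box P Q)
    (hker : ∀ Z ∈ interior (box P Q),
      bcEval (fracWeightedCR P α σ phi th vphi F W) Z = 0) :
    boundaryIntegral S th vphi (bcExp lam * bcFracInt P α σ phi F W) =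
      (Complex.I / 2) • surfaceIntegral S
        (weightA th vphi * (bcExp lam * bcFracInt P α σ phi F W) +
          weightB th vphi * bcConst bcI * (bcExp lam * bcFracInt P α σ phi F W)) := by
  obtain ⟨hth₁, hth₂⟩ := hth
  obtain ⟨hvphi₁, hvphi₂⟩ := hvphi
  have hn₁ : (interior (boxFst P Q)).Nonempty := interior_reProdIm_Icc_nonempty (hPQ 0) (hPQ 1)
  have hn₂ : (interior (boxSnd P Q)).Nonempty := interior_reProdIm_Icc_nonempty (hPQ 2) (hPQ 3)
  obtain ⟨w₁, hw₁⟩ := hn₁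
  obtain ⟨w₂, hw₂⟩ := hn₂
  have hint : interior (box P Q) = interior (boxFst P Q) ×ˢ interior (boxSnd P Q) :=
    interior_prod_eq _ _
  -- The hypotheses concern bicomplex points; freezing the other component at an interior point
  -- turns each into a statement about one complex variable.
  have hm₁ : ∀ z ∈ interior (boxFst P Q), ((z, w₂) : BC) ∈ interior (box P Q) :=
    fun z hz => hint ▸ ⟨hz, hw₂⟩
  have hm₂ : ∀ z ∈ interior (boxSnd P Q), ((w₁, z) : BC) ∈ interior (box P Q) :=
    fun z hz => hint ▸ ⟨hw₁, hz⟩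
  have hs₁ : (bcSigma σ).1 ≠ 0 := fun h => by
    have := congrArg Complex.re h
    simp [bcSigma, bcE, bcEd] at this
    exact (hσ 0).1.ne' this
  have hs₂ : (bcSigma σ).2 ≠ 0 := fun h => by
    have := congrArg Complex.re h
    simp [bcSigma, bcE, bcEd] at this
    exact (hσ 2).1.ne' this
  have hD₁ : closure S.dom₁ ⊆ boxFst P Q := closure_minimal
    (by rintro _ ⟨u, hu, rfl⟩; exact (hS ⟨u, subset_closure hu, rfl⟩).1)
    (isCompact_boxFst P Q).isClosed
  have hD₂ : closure S.dom₂ ⊆ boxSnd P Q := closure_minimal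
    (by rintro _ ⟨u, hu, rfl⟩; exact (hS ⟨u, subset_closure hu, rfl⟩).2)
    (isCompact_boxSnd P Q).isClosed
  have key₁ := curveIntegral_rhoForm_exp_mul_eq (E := (sumPartials phi).1) (s := (bcSigma σ).1)
    (G := (bcFracInt P α σ phi F W).1) (L := lam.1)
    S.jordan₁ (convex_boxFst P Q) (isCompact_boxFst P Q) ⟨w₁, hw₁⟩ hD₁ hs₁
    (fun z hz => Complex.ofReal_ne_zero.2
      (pdX_add_pdY_pos hz (hphi_pos₁ z (interior_subset hz))).ne') hth₁ hvphi₁ hlam_diff₁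
    (fun z hz => congrArg Prod.fst (hlam _ (hm₁ z hz)))
    (fun z hz => congrArg Prod.fst (hker _ (hm₁ z hz)))
    (continuous_fst.comp_continuousOn (hFcont.comp (f := fun z => ((z, w₂) : BC))
      (by fun_prop) fun z hz => ⟨hz, interior_subset hw₂⟩))
    (contDiff_fst.comp_contDiffOn (hFC1.comp (f := fun z => ((z, w₂) : BC))
      (contDiff_id.prodMk contDiff_const).contDiffOn hm₁))
  have key₂ := curveIntegral_rhoForm_exp_mul_eq (E := (sumPartials phi).2) (s := (bcSigma σ).2)
    (G := (bcFracInt P α σ phi F W).2) (L := lam.2)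
    S.jordan₂ (convex_boxSnd P Q) (isCompact_boxSnd P Q) ⟨w₂, hw₂⟩ hD₂ hs₂
    (fun z hz => Complex.ofReal_ne_zero.2
      (pdX_add_pdY_pos hz (hphi_pos₂ z (interior_subset hz))).ne') hth₂ hvphi₂ hlam_diff₂
    (fun z hz => congrArg Prod.snd (hlam _ (hm₂ z hz)))
    (fun z hz => congrArg Prod.snd (hker _ (hm₂ z hz)))
    (continuous_snd.comp_continuousOn (hFcont.comp (f := fun z => ((w₁, z) : BC))
      (by fun_prop) fun z hz => ⟨interior_subset hw₁, hz⟩))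
    (contDiff_snd.comp_contDiffOn (hFC1.comp (f := fun z => ((w₁, z) : BC))
      (contDiff_const.prodMk contDiff_id).contDiffOn hm₂))
  refine Prod.ext ?_ ?_
  · simp only [boundaryIntegral, surfaceIntegral, bcE, bcEd, Prod.fst_add, Prod.smul_fst,
      smul_eq_mul, mul_one, mul_zero, add_zero]
    exact key₁
  · simp only [boundaryIntegral, surfaceIntegral, bcE, bcEd, Prod.snd_add, Prod.smul_snd,
      smul_eq_mul, mul_one, mul_zero, zero_add]
    exact key₂
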